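/- Let $X$ be a compact metric space with metric $d$ and $T\colon X\to X$ a continuous map. Let $\mathcal M_{\rm inv}$ be the set of $T$-invariant Borel probability measures on $X$, and for $\mu\in\mathcal M_{\rm inv}$ let $h_\mu\in[0,\infty]$ be its measure-theoretic (Kolmogorov–Sinai) entropy and $$G_\mu=\Bigl\{x\in X:\ \tfrac1n\sum_{j=0}^{n-1}\delta_{T^jx}\to\mu\ \text{in the weak-star topology}\Bigr\}$$ the set of its generic points. For $Z\subset X$ let $h_{\rm top}(Z)\in[0,\infty]$ be Bowen's topological entropy: with $B_n(x,\epsilon)=\{y: \max_{0\le j<n}d(T^jx,T^jy)<\epsilon\}$ and, for $s\ge 0$, $$H^s_N(Z,\epsilon)=\inf\Bigl\{\sum_i e^{-sn_i}:\ Z\subset\bigcup_i B_{n_i}(x_i,\epsilon),\ n_i\ge \max(N,1)\ \text{for all } i\Bigr\}$$ (at most countable covers), put $H^s(Z,\epsilon)=\lim_{N\to\infty}H^s_N(Z,\epsilon)$, $h_{\rm top}(Z,\epsilon)=\inf\{s\ge0: H^s(Z,\epsilon)=0\}$ and $h_{\rm top}(Z)=\lim_{\epsilon\to0}h_{\rm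 top}(Z,\epsilon)$; in particular $h_{\rm top}(\emptyset)=0$. Suppose that $(X,T)$ is saturated, that is, $h_{\rm top}(G_\mu)=h_\mu$ for every $\mu\in\mathcal M_{\rm inv}$. Let $\mathbb B$ be a real Banach space with dual $\mathbb B^*$, let $\Phi\colon X\to\mathbb B^*$ be continuous for the weak-star topology of $\mathbb B^*$, let $\alpha\in\mathbb B^*$ and $E\subset\mathbb B$. With $A_n\Phi(x)=\frac1n\sum_{j=0}^{n-1}\Phi(T^jx)$, put $$X_\Phi(\alpha;E)=\Bigl\{x\in X:\ \limsup_{n\to\infty}\langle A_n\Phi(x),w\rangle\le\langle\alpha,w\rangle\ \text{for all } w\in E\Bigr\},$$ $$\mathcal M_\Phi(\alpha;E)=\Bigl\{\mu\in\mathcal M_{\rm inv}:\ \int\langle\Phi,w\rangle\,d\mu\le\langle\alpha,w\rangle\ \text{for all } w\in E\Bigr\}.$$ Then: (a) if $\mathcal M_\Phi(\alpha;E)=\emptyset$, then $X_\Phi(\alpha;E)=\emptyset$; (b) if $\mathcal M_\Phi(\alpha;E)\neq\emptyset$, then $$h_{\rm top}\bigl(X_\Phi(\alpha;E)\bigr)=\sup_{\mu\in\mathcal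 M_\Phi(\alpha;E)}h_\mu .$$ -/

import Mathlib

open MeasureTheory Filter Topology
open scoped ENNReal NNReal

noncomputable section

namespace DynSys

/-! ### Bowen's topological entropy of a subset -/

section Topological

variable {X : Type*} [MetricSpace X]

/-- The open ball `B_n(x, ε)` for the Bowen metric `d_n(x, y) = max_{0 ≤ j < n} d(T^j x, T^j y)`. -/
def bowenBall (T : X → X) (n : ℕ) (x : X) (ε : ℝ) : Set X :=
  {y | ∀ j < n, dist (T^[j] y) (T^[j] x) < ε}

/-- `R` encodes the at most countable collection of the balls `B_n(x, ε)`, `(x, n) ∈ R`; it covers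
`Z`, and all the lengths are at least `max N 1`. -/
structure IsBowenCover (T : X → X) (Z : Set X) (ε : ℝ) (N : ℕ) (R : Set (X × ℕ)) : Prop where
  countable : R.Countable
  one_le : ∀ p ∈ R, 1 ≤ p.2
  le : ∀ p ∈ R, N ≤ p.2
  covers : Z ⊆ ⋃ p ∈ R, bowenBall T p.2 p.1 ε

/-- `H^s_N(Z, ε) = inf_R ∑_i exp(-s n_i)`. -/
def bowenPreMeasure (T : X → X) (s : ℝ≥0) (Z : Set X) (ε : ℝ) (N : ℕ) : ℝ≥0∞ :=
  ⨅ (R : Set (X × ℕ)) (_ : IsBowenCover T Z ε N R),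
    ∑' p : R, ENNReal.ofReal (Real.exp (-(s : ℝ) * ((p : X × ℕ).2 : ℝ)))

/-- `H^s(Z, ε)`, the limit of `H^s_N(Z, ε)` as `N → ∞`; the sequence is non-decreasing in `N`, so
the limit is the supremum. -/
def bowenMeasure (T : X → X) (s : ℝ≥0) (Z : Set X) (ε : ℝ) : ℝ≥0∞ :=
  ⨆ N : ℕ, bowenPreMeasure T s Z ε N

/-- `h_top(Z, ε)`, the critical value of `s ≥ 0` above which `H^s(Z, ε)` vanishes. -/
def topEntropyAt (T : X → X) (Z : Set X) (ε : ℝ) : ℝ≥0∞ :=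
  ⨅ (s : ℝ≥0) (_ : bowenMeasure T s Z ε = 0), (s : ℝ≥0∞)

/-- Bowen's topological entropy `h_top(Z) = lim_{ε → 0} h_top(Z, ε)`; as `h_top(Z, ε)` is
non-increasing in `ε`, the limit is the supremum over `ε > 0`. -/
def topEntropy (T : X → X) (Z : Set X) : ℝ≥0∞ :=
  ⨆ (ε : ℝ) (_ : 0 < ε), topEntropyAt T Z ε

end Topological

/-! ### Measure-theoretic entropy -/

section Metric

variable {X : Type*} [MeasurableSpace X]

/-- A finite measurable partition is given by its labelling `ξ : X → Fin k`. This is the Shannon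
entropy `-∑ μ(C) log μ(C)` of the join of `ξ, T⁻¹ξ, …, T^{-(n-1)}ξ`, whose cells are the sets
`{x | ξ (T^j x) = a j for all j < n}`. -/
def joinEntropy (T : X → X) (μ : Measure X) {k : ℕ} (ξ : X → Fin k) (n : ℕ) : ℝ :=
  ∑ a : Fin n → Fin k, Real.negMulLog (μ.real {x | ∀ j : Fin n, ξ (T^[j] x) = a j})

/-- `h_μ(T, ξ)`, the limit of `joinEntropy T μ ξ n / n`; for an invariant `μ` the limit exists. -/
def partitionEntropy (T : X → X) (μ : Measure X) {k : ℕ} (ξ : X → Fin k) : ℝ≥0∞ :=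
  limsup (fun n : ℕ => ENNReal.ofReal (joinEntropy T μ ξ n / n)) atTop

/-- The Kolmogorov–Sinai entropy `h_μ`: the supremum over all finite measurable partitions. -/
def measureEntropy (T : X → X) (μ : Measure X) : ℝ≥0∞ :=
  ⨆ (k : ℕ) (ξ : X → Fin k) (_ : Measurable ξ), partitionEntropy T μ ξ

/-- The set of invariant probability measures. -/
def invariantMeasures (T : X → X) : Set (ProbabilityMeasure X) :=
  {μ | MeasurePreserving T (μ : Measure X) (μ : Measure X)}

/-- The empirical measure `(1/n) ∑_{j<n} δ_{T^j x}` (a probability measure for `n ≥ 1`). -/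
def empiricalMeasure (T : X → X) (n : ℕ) (x : X) : FiniteMeasure X :=
  (n : ℝ≥0)⁻¹ • ∑ j ∈ Finset.range n, (diracProba (T^[j] x)).toFiniteMeasure

end Metric

/-! ### Generic points and saturated systems -/

section Saturated

variable {X : Type*} [MetricSpace X] [MeasurableSpace X] [BorelSpace X]

/-- The set `G_μ` of `μ`-generic points. -/
def genericPoints (T : X → X) (μ : ProbabilityMeasure X) : Set X :=
  {x | Tendsto (fun n : ℕ => empiricalMeasure T n x) atTop (𝓝 μ.toFiniteMeasure)}

/-- `(X, T)` is saturated: `h_top(G_μ) = h_μ` for every invariant probability measure `μ`. -/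
def IsSaturated (T : X → X) : Prop :=
  ∀ μ ∈ invariantMeasures T, topEntropy T (genericPoints T μ) = measureEntropy T (μ : Measure X)

end Saturated

/-! ### Birkhoff averages with values in a dual Banach space -/

section Birkhoff

variable {X : Type*} {B : Type*} [NormedAddCommGroup B] [NormedSpace ℝ B]

/-- `X_Φ(α; E)`: the points `x` with `limsup ⟨A_n Φ(x), w⟩ ≤ ⟨α, w⟩` for all `w ∈ E`. The upper
limit is taken in the extended reals. -/
def levelSet (T : X → X) (Φ : X → WeakDual ℝ B) (α : WeakDual ℝ B) (E : Set B) : Set X :=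
  {x | ∀ w ∈ E,
    limsup (fun n : ℕ => (((birkhoffAverage ℝ T Φ n x) w : ℝ) : EReal)) atTop
      ≤ ((α w : ℝ) : EReal)}

/-- `M_Φ(α; E)`: the invariant probability measures `μ` with `∫ ⟨Φ, w⟩ dμ ≤ ⟨α, w⟩` for all
`w ∈ E`. -/
def levelMeasures [MeasurableSpace X] (T : X → X) (Φ : X → WeakDual ℝ B) (α : WeakDual ℝ B)
    (E : Set B) : Set (ProbabilityMeasure X) :=
  {μ | μ ∈ invariantMeasures T ∧ ∀ w ∈ E, ∫ x, Φ x w ∂(μ : Measure X) ≤ α w}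

end Birkhoff

end DynSys

end

/-!
Suppose that the empirical measures of `x` accumulate at `μ`, and let `t > h_μ`. For a finite
partition with `μ`-null boundaries and a word length `m`, the words of length `m` occur along the
orbit of `x`, at infinitely many times, with frequencies close to their `μ`-masses. A code `q`
adapted to these masses has mean length close to the Shannon entropy of the `m`-fold join, which is
less than `m t` for some `m`. So for one of the residues `r < m` the consecutive words of the orbit
of `T^r x` have, infinitely often, an average code length of at most `m t`. By Kraft's inequality at
most `exp (L m t)` strings of `L` words have total code length at most `L m t`; hence for `s > t`
the weights `exp (-s m L)` of the corresponding Bowen balls are summable, and `H^s` vanishes on the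
points of this kind. With rational code lengths there are only countably many choices of
`(m, q, r)`. It follows that `h_top(Z) ≤ t` as soon as each point of `Z` has a limit measure of
entropy at most `t` (Bowen).

The limit measures of a point of `X_Φ(α; E)` exist by compactness and lie in `M_Φ(α; E)`, which
proves (a) and the upper bound in (b). The lower bound holds because `G_μ ⊆ X_Φ(α; E)` for every
`μ ∈ M_Φ(α; E)`.
-/

noncomputable section

namespace DynSys

section BowenMeasure

variable {X : Type*} [MetricSpace X] {T : X → X} {s : ℝ≥0} {Z Z' : Set X} {ε : ℝ} {N : ℕ}
  {ι : Type*}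

/-- The weight `e^{-sn}` that a Bowen ball of length `n` contributes to `H^s`. -/
def bowenWeight (s : ℝ≥0) (n : ℕ) : ℝ≥0∞ :=
  ENNReal.ofReal (Real.exp (-(s : ℝ) * n))

lemma bowenWeight_antitone (s : ℝ≥0) : Antitone (bowenWeight s) := fun m n hmn => by
  refine ENNReal.ofReal_le_ofReal (Real.exp_le_exp.2 ?_)
  rw [neg_mul, neg_mul, neg_le_neg_iff]
  gcongr

lemma bowenPreMeasure_eq_iInf :
    bowenPreMeasure T s Z ε N =
      ⨅ (R : Set (X × ℕ)) (_ : IsBowenCover T Z ε N R), ∑' p : R, bowenWeight s (p : X × ℕ).2 :=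
  rfl

lemma bowenPreMeasure_mono (h : Z ⊆ Z') :
    bowenPreMeasure T s Z ε N ≤ bowenPreMeasure T s Z' ε N :=
  le_iInf₂ fun _ hR => iInf₂_le _ ⟨hR.countable, hR.one_le, hR.le, h.trans hR.covers⟩

lemma bowenMeasure_mono (h : Z ⊆ Z') : bowenMeasure T s Z ε ≤ bowenMeasure T s Z' ε :=
  iSup_mono fun _ => bowenPreMeasure_mono h

lemma topEntropy_mono (h : Z ⊆ Z') : topEntropy T Z ≤ topEntropy T Z' :=
  iSup₂_mono fun _ _ => le_iInf₂ fun s hs =>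
    iInf₂_le s (le_bot_iff.1 ((bowenMeasure_mono h).trans hs.le))

lemma bowenPreMeasure_le_tsum [Countable ι] {x : ι → X} {n : ι → ℕ} (hn : ∀ i, max N 1 ≤ n i)
    (hZ : Z ⊆ ⋃ i, bowenBall T (n i) (x i) ε) :
    bowenPreMeasure T s Z ε N ≤ ∑' i, bowenWeight s (n i) := by
  have hcover : IsBowenCover T Z ε N (Set.range fun i => (x i, n i)) :=
    { countable := Set.countable_range _
      one_le := Set.forall_mem_range.2 fun i => (le_max_right N 1).trans (hn i)
      le := Set.forall_mem_range.2 fun i => (le_max_left N 1).trans (hn i)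
      covers := by rwa [Set.biUnion_range] }
  rw [bowenPreMeasure_eq_iInf]
  exact (iInf₂_le _ hcover).trans
    (ENNReal.tsum_le_tsum_comp_of_surjective
      (Set.rangeFactorization_surjective (f := fun i => (x i, n i)))
      fun p => bowenWeight s (p : X × ℕ).2)

lemma bowenPreMeasure_le_tsum_of_subset_bowenBall [Countable ι] {W : ι → Set X} {n : ι → ℕ}
    (hn : ∀ i, max N 1 ≤ n i) (hW : ∀ i, ∀ y ∈ W i, W i ⊆ bowenBall T (n i) y ε)
    (hZ : Z ⊆ ⋃ i, W i) :
    bowenPreMeasure T s Z ε N ≤ ∑' i, bowenWeight s (n i) := by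
  let I := {i // (W i).Nonempty}
  have hcover : Z ⊆ ⋃ i : I, bowenBall T (n i) i.2.some ε := fun y hy => by
    obtain ⟨i, hi⟩ := Set.mem_iUnion.1 (hZ hy)
    let j : I := ⟨i, y, hi⟩
    exact Set.mem_iUnion.2 ⟨j, hW i _ j.2.some_mem hi⟩
  exact (bowenPreMeasure_le_tsum (fun i : I => hn i) hcover).trans
    (ENNReal.tsum_comp_le_tsum_of_injective Subtype.val_injective fun i => bowenWeight s (n i))

lemma exists_isBowenCover_tsum_lt {a : ℝ≥0∞} (h : bowenPreMeasure T s Z ε N < a) :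
    ∃ R, IsBowenCover T Z ε N R ∧ ∑' p : R, bowenWeight s (p : X × ℕ).2 < a := by
  simpa only [bowenPreMeasure_eq_iInf, iInf_lt_iff, exists_prop] using h

lemma bowenPreMeasure_iUnion_le [Countable ι] (Z : ι → Set X) :
    bowenPreMeasure T s (⋃ i, Z i) ε N ≤ ∑' i, bowenPreMeasure T s (Z i) ε N := by
  refine ENNReal.le_of_forall_pos_le_add fun θ hθ hfin => ?_
  obtain ⟨η, hη, hηθ⟩ := ENNReal.exists_pos_sum_of_countable' (ENNReal.coe_pos.2 hθ).ne' ι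
  choose R hR hRη using fun i => exists_isBowenCover_tsum_lt
    (ENNReal.lt_add_right (ENNReal.ne_top_of_tsum_ne_top hfin.ne i) (hη i).ne')
  have (i : ι) : Countable (R i) := (hR i).countable
  have hcover : ⋃ i, Z i ⊆ ⋃ p : Σ i, R i, bowenBall T (p.2 : X × ℕ).2 (p.2 : X × ℕ).1 ε := by
    rw [Set.iUnion_sigma]
    refine Set.iUnion_mono fun i => (hR i).covers.trans ?_
    rw [Set.biUnion_eq_iUnion]
  calc bowenPreMeasure T s (⋃ i, Z i) ε N
      ≤ ∑' p : Σ i, R i, bowenWeight s (p.2 : X × ℕ).2 :=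
        bowenPreMeasure_le_tsum
          (fun p => max_le ((hR p.1).le _ p.2.2) ((hR p.1).one_le _ p.2.2)) hcover
    _ = ∑' i, ∑' p : R i, bowenWeight s (p : X × ℕ).2 := ENNReal.tsum_sigma' _
    _ ≤ ∑' i, (bowenPreMeasure T s (Z i) ε N + η i) := ENNReal.tsum_le_tsum fun i => (hRη i).le
    _ = ∑' i, bowenPreMeasure T s (Z i) ε N + ∑' i, η i := ENNReal.tsum_add
    _ ≤ ∑' i, bowenPreMeasure T s (Z i) ε N + θ := by gcongr

lemma bowenMeasure_iUnion_le [Countable ι] (Z : ι → Set X) :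
    bowenMeasure T s (⋃ i, Z i) ε ≤ ∑' i, bowenMeasure T s (Z i) ε :=
  iSup_le fun N => (bowenPreMeasure_iUnion_le Z).trans <| ENNReal.tsum_le_tsum fun _ =>
    le_iSup (bowenPreMeasure T s _ ε) N

-- The Borel–Cantelli argument: the cells outside a large finite set still cover `Z`.
lemma bowenMeasure_eq_zero_of_forall_exists_mem [Countable ι] {W : ι → Set X} {n : ι → ℕ}
    (hW : ∀ i, ∀ y ∈ W i, W i ⊆ bowenBall T (n i) y ε)
    (hsum : ∑' i, bowenWeight s (n i) ≠ ∞) (hZ : ∀ y ∈ Z, ∀ N, ∃ i, N ≤ n i ∧ y ∈ W i) :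
    bowenMeasure T s Z ε = 0 := by
  refine ENNReal.iSup_eq_zero.2 fun N => le_bot_iff.1 ?_
  refine ge_of_tendsto (ENNReal.tendsto_tsum_compl_atTop_zero hsum) (Eventually.of_forall ?_)
  intro F
  let I := {i : {i // i ∉ F} // max N 1 ≤ n i}
  have hcover : Z ⊆ ⋃ i : I, W i := fun y hy => by
    obtain ⟨i, hi, hyi⟩ := hZ y hy (max (max N 1) (F.sup n + 1))
    have hiF : i ∉ F := fun h => by have := F.le_sup (f := n) h; omega
    exact Set.mem_iUnion.2 ⟨⟨⟨i, hiF⟩, (le_max_left _ _).trans hi⟩, hyi⟩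
  refine (bowenPreMeasure_le_tsum_of_subset_bowenBall (fun i : I => i.2) (fun i => hW i)
    hcover).trans ?_
  exact ENNReal.tsum_comp_le_tsum_of_injective Subtype.val_injective
    fun i : {i // i ∉ F} => bowenWeight s (n i)

end BowenMeasure

section Cylinder

variable {X : Type*} {T : X → X} {ι : Type*} {V : ι → Set X} {n : ℕ} {u : Fin n → ι}

/-- The points whose first `n` iterates visit `V (u 0), …, V (u (n - 1))`. The sets `V i` may form
a cover by small balls, or they may be the fibres of a labelling as in `joinEntropy`. -/
def cylinder (T : X → X) (V : ι → Set X) {n : ℕ} (u : Fin n → ι) : Set X :=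
  {y | ∀ j : Fin n, T^[j] y ∈ V (u j)}

lemma cylinder_eq_iInter : cylinder T V u = ⋂ j : Fin n, T^[j] ⁻¹' V (u j) :=
  Set.ofPred_forall _

lemma iUnion_cylinder (hV : ⋃ i, V i = Set.univ) : ⋃ u : Fin n → ι, cylinder T V u = Set.univ :=
  Set.iUnion_eq_univ_iff.2 fun y => by
    choose w hw using Set.iUnion_eq_univ_iff.1 hV
    exact ⟨fun j => w (T^[j] y), fun j => hw _⟩

variable [MetricSpace X] {s : ℝ≥0} {Z : Set X} {ε : ℝ} {N m : ℕ} {y z : X}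

lemma mem_bowenBall_of_mem_cylinder (hV : ∀ i, ∀ y ∈ V i, V i ⊆ Metric.ball y ε)
    (hy : y ∈ cylinder T V u) (hz : z ∈ cylinder T V u) : z ∈ bowenBall T n y ε :=
  fun j hj => hV _ _ (hy ⟨j, hj⟩) (hz ⟨j, hj⟩)

lemma mem_bowenBall_add (hm : z ∈ bowenBall T m y ε)
    (hn : T^[m] z ∈ bowenBall T n (T^[m] y) ε) : z ∈ bowenBall T (m + n) y ε := fun j hj => by
  rcases lt_or_ge j m with hjm | hmj
  · exact hm j hjm
  · obtain ⟨i, rfl⟩ := Nat.exists_eq_add_of_le' hmj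
    simpa only [Function.iterate_add_apply] using hn i (by omega)

lemma ball_subset_ball_two_mul {c : X} (hy : y ∈ Metric.ball c ε) :
    Metric.ball c ε ⊆ Metric.ball y (2 * ε) :=
  Metric.ball_subset_ball' (by linarith [Metric.mem_ball'.1 hy])

lemma IsBowenCover.bowenPreMeasure_preimage_iterate_le [Fintype ι] {R : Set (X × ℕ)}
    (hR : IsBowenCover T Z ε N R) (hVuniv : ⋃ i, V i = Set.univ)
    (hV : ∀ i, ∀ y ∈ V i, V i ⊆ Metric.ball y (2 * ε)) (r : ℕ) :
    bowenPreMeasure T s (T^[r] ⁻¹' Z) (2 * ε) N ≤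
      Fintype.card (Fin r → ι) * ∑' p : R, bowenWeight s (p : X × ℕ).2 := by
  have : Countable R := hR.countable
  let W (i : (Fin r → ι) × R) : Set X :=
    cylinder T V i.1 ∩ T^[r] ⁻¹' bowenBall T (i.2 : X × ℕ).2 (i.2 : X × ℕ).1 ε
  have hW (i) : ∀ y ∈ W i, W i ⊆ bowenBall T (r + (i.2 : X × ℕ).2) y (2 * ε) :=
    fun y hy z hz => mem_bowenBall_add (mem_bowenBall_of_mem_cylinder hV hy.1 hz.1) fun j hj =>
      ball_subset_ball_two_mul (hy.2 j hj) (hz.2 j hj)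
  have hcover : T^[r] ⁻¹' Z ⊆ ⋃ i, W i := fun y hy => by
    obtain ⟨u, hu⟩ := Set.iUnion_eq_univ_iff.1 (iUnion_cylinder (T := T) hVuniv) y
    obtain ⟨p, hp, hpy⟩ := Set.mem_iUnion₂.1 (hR.covers hy)
    exact Set.mem_iUnion.2 ⟨(u, ⟨p, hp⟩), hu, hpy⟩
  calc bowenPreMeasure T s (T^[r] ⁻¹' Z) (2 * ε) N
      ≤ ∑' i : (Fin r → ι) × R, bowenWeight s (r + (i.2 : X × ℕ).2) :=
        bowenPreMeasure_le_tsum_of_subset_bowenBall (fun i =>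
          (max_le (hR.le _ i.2.2) (hR.one_le _ i.2.2)).trans (Nat.le_add_left _ r)) hW hcover
    _ ≤ ∑' i : (Fin r → ι) × R, bowenWeight s (i.2 : X × ℕ).2 :=
        ENNReal.tsum_le_tsum fun i => bowenWeight_antitone s (Nat.le_add_left _ r)
    _ = ∑' (_ : Fin r → ι) (p : R), bowenWeight s (p : X × ℕ).2 :=
        ENNReal.tsum_prod (f := fun _ (p : R) => bowenWeight s (p : X × ℕ).2)
    _ = Fintype.card (Fin r → ι) * ∑' p : R, bowenWeight s (p : X × ℕ).2 := by
        rw [tsum_fintype, Finset.sum_const, Finset.card_univ, nsmul_eq_mul]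

lemma bowenPreMeasure_preimage_iterate_eq_zero [Finite ι] (hVuniv : ⋃ i, V i = Set.univ)
    (hV : ∀ i, ∀ y ∈ V i, V i ⊆ Metric.ball y (2 * ε)) (r : ℕ)
    (hZ : bowenPreMeasure T s Z ε N = 0) :
    bowenPreMeasure T s (T^[r] ⁻¹' Z) (2 * ε) N = 0 := by
  have := Fintype.ofFinite ι
  refine le_bot_iff.1 (le_of_forall_pos_le_add fun θ hθ => ?_)
  obtain ⟨R, hR, hRθ⟩ := exists_isBowenCover_tsum_lt (hZ.trans_lt
    (ENNReal.div_pos hθ.ne' (ENNReal.natCast_ne_top (Fintype.card (Fin r → ι)))))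
  calc bowenPreMeasure T s (T^[r] ⁻¹' Z) (2 * ε) N
      ≤ Fintype.card (Fin r → ι) * ∑' p : R, bowenWeight s (p : X × ℕ).2 :=
        hR.bowenPreMeasure_preimage_iterate_le hVuniv hV r
    _ ≤ Fintype.card (Fin r → ι) * (θ / Fintype.card (Fin r → ι)) := by gcongr
    _ ≤ 0 + θ := ENNReal.mul_div_le.trans (zero_add θ).ge

lemma exists_fin_cover_ball [CompactSpace X] (hε : 0 < ε) :
    ∃ (k : ℕ) (c : Fin k → X), ⋃ i, Metric.ball (c i) ε = Set.univ := by
  obtain ⟨S, -, hSf, hS⟩ := finite_cover_balls_of_compact (isCompact_univ (X := X)) hε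
  obtain ⟨k, c, -, rfl⟩ := hSf.fin_param
  exact ⟨k, c, Set.univ_subset_iff.1 (by rwa [Set.biUnion_range] at hS)⟩

lemma bowenMeasure_preimage_iterate_eq_zero [CompactSpace X] (hε : 0 < ε) (r : ℕ)
    (hZ : bowenMeasure T s Z ε = 0) : bowenMeasure T s (T^[r] ⁻¹' Z) (2 * ε) = 0 := by
  obtain ⟨k, c, hc⟩ := exists_fin_cover_ball (X := X) hε
  exact ENNReal.iSup_eq_zero.2 fun N => bowenPreMeasure_preimage_iterate_eq_zero hc
    (fun i y hy => ball_subset_ball_two_mul hy) r (ENNReal.iSup_eq_zero.1 hZ N)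

end Cylinder

section Code

variable {A : Type*} [Fintype A]

-- The Shannon code `-log (p a)` is raised by `θ` so that smoothing `p` keeps Kraft's inequality.
lemma exists_rat_code {p : A → ℝ} (hp : ∀ a, 0 ≤ p a) (hp1 : ∑ a, p a = 1) {h : ℝ}
    (hh : ∑ a, Real.negMulLog (p a) < h) :
    ∃ q : A → ℚ, ∑ a, Real.exp (-(q a : ℝ)) ≤ 1 ∧ ∑ a, p a * q a < h := by
  have hA : 0 < (Fintype.card A : ℝ) := by
    rcases isEmpty_or_nonempty A with hA | hA
    · simp at hp1
    · exact_mod_cast Fintype.card_pos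
  obtain ⟨θ, hθ, hθh⟩ : ∃ θ > 0, ∑ a, Real.negMulLog (p a) + 2 * θ < h :=
    ⟨(h - ∑ a, Real.negMulLog (p a)) / 3, by linarith, by linarith⟩
  have hpos (a : A) : 0 < p a + θ / Fintype.card A :=
    add_pos_of_nonneg_of_pos (hp a) (by positivity)
  choose q hq_gt hq_lt using fun a => exists_rat_btwn
    (show θ - Real.log (p a + θ / Fintype.card A) < 2 * θ - Real.log (p a + θ / Fintype.card A) by
      linarith)
  refine ⟨q, ?_, lt_of_le_of_lt ?_ hθh⟩
  · calc ∑ a, Real.exp (-(q a : ℝ))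
        ≤ ∑ a, Real.exp (-θ) * (p a + θ / Fintype.card A) := Finset.sum_le_sum fun a _ => by
          rw [← Real.exp_log (hpos a), ← Real.exp_add, Real.exp_le_exp]
          linarith [hq_gt a]
      _ = Real.exp (-θ) * (θ + 1) := by
          rw [← Finset.mul_sum, Finset.sum_add_distrib, hp1, Finset.sum_const, Finset.card_univ,
            nsmul_eq_mul, mul_div_cancel₀ _ hA.ne', add_comm]
      _ ≤ Real.exp (-θ) * Real.exp θ := by gcongr; exact Real.add_one_le_exp θ
      _ = 1 := by rw [← Real.exp_add, neg_add_cancel, Real.exp_zero]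
  · calc ∑ a, p a * q a ≤ ∑ a, (Real.negMulLog (p a) + p a * (2 * θ)) :=
          Finset.sum_le_sum fun a _ => by
          rcases (hp a).eq_or_lt with ha | ha
          · simp [← ha]
          · have hlog : Real.log (p a) ≤ Real.log (p a + θ / Fintype.card A) :=
              Real.log_le_log ha (le_add_of_nonneg_right (by positivity))
            rw [Real.negMulLog, neg_mul, ← mul_neg, ← mul_add]
            gcongr
            linarith [hq_lt a]
      _ = ∑ a, Real.negMulLog (p a) + 2 * θ := by
          rw [Finset.sum_add_distrib, ← Finset.sum_mul, hp1, one_mul]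

lemma natCard_sum_code_le_exp {q : A → ℝ} (hq : ∑ a, Real.exp (-q a) ≤ 1) (L : ℕ) (c : ℝ) :
    (Nat.card {b : Fin L → A // ∑ i, q (b i) ≤ c} : ℝ) ≤ Real.exp c := by
  classical
  rw [Nat.card_eq_fintype_card, Fintype.card_subtype, Finset.cast_card]
  calc ∑ b : Fin L → A with ∑ i, q (b i) ≤ c, (1 : ℝ)
      ≤ ∑ b : Fin L → A with ∑ i, q (b i) ≤ c, Real.exp c * ∏ i, Real.exp (-q (b i)) :=
        Finset.sum_le_sum fun b hb => by
          rw [← Real.exp_sum, ← Real.exp_add, Finset.sum_neg_distrib, Real.one_le_exp_iff]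
          linarith [(Finset.mem_filter.1 hb).2]
    _ ≤ ∑ b : Fin L → A, Real.exp c * ∏ i, Real.exp (-q (b i)) :=
        Finset.sum_le_sum_of_subset_of_nonneg (Finset.filter_subset _ _) fun _ _ _ => by positivity
    _ = Real.exp c * (∑ a, Real.exp (-q a)) ^ L := by rw [← Finset.mul_sum, Fintype.sum_pow]
    _ ≤ Real.exp c :=
        mul_le_of_le_one_right (Real.exp_pos c).le (pow_le_one₀ (by positivity) hq)

lemma tsum_code_bowenWeight_le {q : A → ℝ} (hq : ∑ a, Real.exp (-q a) ≤ 1) (s : ℝ≥0) (m L : ℕ)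
    (t : ℝ) :
    ∑' _ : {b : Fin L → A // ∑ i, q (b i) ≤ L * t}, bowenWeight s (m * L) ≤
      ENNReal.ofReal (Real.exp (t - s * m)) ^ L := by
  calc ∑' _ : {b : Fin L → A // ∑ i, q (b i) ≤ L * t}, bowenWeight s (m * L)
      = ENNReal.ofReal (Nat.card {b : Fin L → A // ∑ i, q (b i) ≤ L * t}) *
          bowenWeight s (m * L) := by
        rw [ENNReal.tsum_const, ENat.card_eq_coe_natCard, ENNReal.ofReal_natCast]
        rfl
    _ ≤ ENNReal.ofReal (Real.exp (L * t)) * bowenWeight s (m * L) := by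
        gcongr
        exact natCard_sum_code_le_exp hq L _
    _ = ENNReal.ofReal (Real.exp (t - s * m)) ^ L := by
        rw [bowenWeight, ← ENNReal.ofReal_mul (Real.exp_pos _).le, ← Real.exp_add,
          ← ENNReal.ofReal_pow (Real.exp_pos _).le, ← Real.exp_nat_mul]
        congr 2
        push_cast
        ring

variable {X : Type*}

/-- The points that, for infinitely many `L`, follow under `S` a string of `L` symbols of total
code length at most `L * t`, where `q` gives the code lengths and `V` the cells of the symbols. -/
def codedSet {A : Type*} (S : X → X) (V : A → Set X) (q : A → ℝ) (t : ℝ) : Set X :=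
  {y | ∃ᶠ L : ℕ in atTop, ∃ b : Fin L → A, ∑ i, q (b i) ≤ L * t ∧ y ∈ cylinder S V b}

variable [MetricSpace X] {T : X → X} {V : A → Set X} {m L : ℕ} {ε : ℝ} {y z : X}

lemma mem_bowenBall_mul_of_mem_cylinder {A : Type*} {V : A → Set X}
    (hV : ∀ a, ∀ y ∈ V a, V a ⊆ bowenBall T m y ε) {b : Fin L → A} (hy : y ∈ cylinder T^[m] V b)
    (hz : z ∈ cylinder T^[m] V b) : z ∈ bowenBall T (m * L) y ε := by
  induction L with
  | zero => exact fun j hj => absurd hj (Nat.not_lt_zero j)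
  | succ L ih =>
    rw [Nat.mul_succ]
    refine mem_bowenBall_add (ih (b := fun i => b i.castSucc) (fun i => hy i.castSucc)
      fun i => hz i.castSucc) ?_
    rw [Function.iterate_mul]
    exact hV _ _ (hy (Fin.last L)) (hz (Fin.last L))

lemma bowenMeasure_codedSet_eq_zero (hV : ∀ a, ∀ y ∈ V a, V a ⊆ bowenBall T m y ε) (hm : 0 < m)
    {q : A → ℝ} (hq : ∑ a, Real.exp (-q a) ≤ 1) {t : ℝ} {s : ℝ≥0} (hts : t < s * m) :
    bowenMeasure T s (codedSet T^[m] V q t) ε = 0 := by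
  let I := Σ L : ℕ, {b : Fin L → A // ∑ i, q (b i) ≤ L * t}
  have hsum : ∑' i : I, bowenWeight s (m * i.1) ≠ ∞ := by
    refine ne_top_of_le_ne_top ?_ ((ENNReal.tsum_sigma' _).trans_le
      (ENNReal.tsum_le_tsum fun L => tsum_code_bowenWeight_le hq s m L t))
    rw [ENNReal.tsum_geometric, ENNReal.inv_ne_top]
    refine (tsub_pos_iff_lt.2 (ENNReal.ofReal_lt_one.2 (Real.exp_lt_one_iff.2 ?_))).ne'
    linarith
  refine bowenMeasure_eq_zero_of_forall_exists_mem (W := fun i : I => cylinder T^[m] V i.2.1)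
    (fun i y hy z hz => mem_bowenBall_mul_of_mem_cylinder hV hy hz) hsum fun y hy N => ?_
  obtain ⟨L, hL, b, hb, hyb⟩ := frequently_atTop.1 hy N
  exact ⟨⟨L, b, hb⟩, hL.trans (Nat.le_mul_of_pos_left L hm), hyb⟩

end Code

section Average

variable {X M : Type*} [AddCommMonoid M]

lemma birkhoffSum_mul (T : X → X) (g : X → M) (m L : ℕ) (x : X) :
    birkhoffSum T g (m * L) x = ∑ r ∈ Finset.range m, birkhoffSum T^[m] g L (T^[r] x) := by
  induction L with
  | zero => simp
  | succ L ih =>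
    simp only [Nat.mul_succ, birkhoffSum_add, ih, birkhoffSum_succ, Finset.sum_add_distrib]
    congr 1
    refine Finset.sum_congr rfl fun r _ => ?_
    rw [← Function.iterate_mul, ← Function.iterate_add_apply, ← Function.iterate_add_apply,
      add_comm]

variable {T : X → X} {g : X → ℝ} {x : X} {m : ℕ} {c c' : ℝ}

lemma frequently_birkhoffSum_mul_le {a : ℝ} (ha : ∀ y, a ≤ g y) (hm : 0 < m) (hc : c < c')
    (h : ∃ᶠ n : ℕ in atTop, birkhoffSum T g n x ≤ n * c) :
    ∃ᶠ L : ℕ in atTop, birkhoffSum T g (m * L) x ≤ m * (L * c') := by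
  have hlarge : ∀ᶠ L : ℕ in atTop, |c - a| ≤ L * (c' - c) :=
    (tendsto_natCast_atTop_atTop.atTop_mul_const (sub_pos.2 hc)).eventually_ge_atTop _
  have hdiv : Tendsto (fun n : ℕ => n / m) atTop atTop := Nat.tendsto_div_const_atTop hm.ne'
  refine hdiv.frequently ((h.and_eventually (hdiv.eventually hlarge)).mono fun n ⟨hn, hL⟩ => ?_)
  have hsplit : birkhoffSum T g n x =
      birkhoffSum T g (m * (n / m)) x + birkhoffSum T g (n % m) (T^[m * (n / m)] x) := by
    rw [← birkhoffSum_add, Nat.div_add_mod]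
  have hn' : (n : ℝ) = m * (n / m : ℕ) + (n % m : ℕ) := by exact_mod_cast (Nat.div_add_mod n m).symm
  have hrem : (n % m : ℕ) * a ≤ birkhoffSum T g (n % m) (T^[m * (n / m)] x) := by
    simpa [birkhoffSum] using Finset.card_nsmul_le_sum (Finset.range (n % m))
      (fun j => g (T^[j] (T^[m * (n / m)] x))) a fun j _ => ha _
  have hmod : (n % m : ℕ) * (c - a) ≤ m * |c - a| := by
    refine (mul_le_mul_of_nonneg_left (le_abs_self _) (Nat.cast_nonneg _)).trans ?_
    gcongr
    exact (Nat.mod_lt n hm).le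
  have hm_mul : m * |c - a| ≤ m * ((n / m : ℕ) * (c' - c)) := by gcongr
  rw [hsplit, hn'] at hn
  linarith

lemma exists_frequently_birkhoffSum_iterate_le
    (h : ∃ᶠ L : ℕ in atTop, birkhoffSum T g (m * L) x ≤ m * (L * c)) (hm : 0 < m) :
    ∃ r, ∃ᶠ L : ℕ in atTop, birkhoffSum T^[m] g L (T^[r] x) ≤ L * c := by
  by_contra! hlt
  refine h ?_
  have hall : ∀ᶠ L : ℕ in atTop, ∀ r ∈ Finset.range m, L * c < birkhoffSum T^[m] g L (T^[r] x) :=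
    (Finset.eventually_all _).2 fun r _ => hlt r
  filter_upwards [hall] with L hL
  rw [not_le, birkhoffSum_mul]
  calc m * (L * c) = ∑ _r ∈ Finset.range m, (L * c : ℝ) := by simp
    _ < _ := Finset.sum_lt_sum_of_nonempty (Finset.nonempty_range_iff.2 hm.ne') hL

end Average

section Portmanteau

variable {X A : Type*} [MeasurableSpace X] [Fintype A] [MeasurableSpace A]
  [MeasurableSingletonClass A] {w : X → A}

lemma integral_comp_fintype (hw : Measurable w) (μ : Measure X) [IsFiniteMeasure μ] (g : A → ℝ) :
    ∫ y, g (w y) ∂μ = ∑ a, μ.real (w ⁻¹' {a}) * g a := by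
  rw [← integral_map hw.aemeasurable (Measurable.of_discrete).aestronglyMeasurable,
    integral_fintype .of_finite]
  simp only [map_measureReal_apply hw (measurableSet_singleton _), smul_eq_mul]

variable [TopologicalSpace X] [HasOuterApproxClosed X] [OpensMeasurableSpace X] {ι : Type*}
  {F : Filter ι} {νs : ι → FiniteMeasure X} {ν : FiniteMeasure X}

lemma tendsto_finiteMeasure_of_null_frontier (h : Tendsto νs F (𝓝 ν)) {S : Set X}
    (hS : (ν : Measure X) (frontier S) = 0) : Tendsto (fun i => νs i S) F (𝓝 (ν S)) := by
  rcases eq_or_ne ν 0 with rfl | hν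
  · refine tendsto_of_tendsto_of_tendsto_of_le_of_le tendsto_const_nhds ?_ (fun _ => zero_le)
      fun i => (νs i).apply_le_mass S
    simpa using h.mass
  · have : Nonempty X := by
      by_contra! hX
      exact hν (Subtype.ext (Subsingleton.elim _ _))
    have hS' : ν.normalize (frontier S) = 0 := by
      rw [FiniteMeasure.normalize_eq_of_nonzero ν hν, ν.null_iff_toMeasure_null _ |>.2 hS,
        mul_zero]
    simp only [fun i => (νs i).self_eq_mass_mul_normalize S, ν.self_eq_mass_mul_normalize S]
    exact h.mass.mul (ProbabilityMeasure.tendsto_measure_of_null_frontier_of_tendsto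
      (FiniteMeasure.tendsto_normalize_of_tendsto h hν) hS')

lemma tendsto_integral_comp_of_null_frontier (h : Tendsto νs F (𝓝 ν)) (hw : Measurable w)
    (hwf : ∀ a, (ν : Measure X) (frontier (w ⁻¹' {a})) = 0) (g : A → ℝ) :
    Tendsto (fun i => ∫ y, g (w y) ∂(νs i : Measure X)) F
      (𝓝 (∑ a, (ν : Measure X).real (w ⁻¹' {a}) * g a)) := by
  simp only [integral_comp_fintype hw]
  exact tendsto_finsetSum _ fun a _ => (NNReal.tendsto_coe.2
    (tendsto_finiteMeasure_of_null_frontier h (hwf a))).mul_const _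

end Portmanteau

section LimitMeasures

variable {X : Type*} [MeasurableSpace X]

lemma integral_empiricalMeasure [MeasurableSingletonClass X] (T : X → X) (f : X → ℝ) (n : ℕ)
    (x : X) : ∫ y, f y ∂(empiricalMeasure T n x : Measure X) = birkhoffAverage ℝ T f n x := by
  have hdirac (j : ℕ) : ∫ y, f y ∂(diracProba (T^[j] x) : Measure X) = f (T^[j] x) :=
    integral_dirac f _
  simp only [empiricalMeasure, FiniteMeasure.toMeasure_smul, FiniteMeasure.toMeasure_sum]
  rw [integral_smul_nnreal_measure, integral_finsetSum_measure fun j _ => ?_]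
  · simp only [ProbabilityMeasure.toMeasure_comp_toFiniteMeasure_eq_toMeasure, hdirac,
      birkhoffAverage, birkhoffSum, NNReal.smul_def, NNReal.coe_inv, NNReal.coe_natCast]
  · exact integrable_dirac enorm_lt_top

lemma mass_empiricalMeasure (T : X → X) {n : ℕ} (hn : n ≠ 0) (x : X) :
    (empiricalMeasure T n x).mass = 1 := by
  have hsum : (∑ j ∈ Finset.range n, (diracProba (T^[j] x)).toFiniteMeasure).mass = n := by
    rw [← ENNReal.coe_inj, FiniteMeasure.ennreal_mass, FiniteMeasure.toMeasure_sum]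
    simp
  rw [empiricalMeasure, FiniteMeasure.mass, FiniteMeasure.smul_apply, ← FiniteMeasure.mass, hsum,
    smul_eq_mul, inv_mul_cancel₀ (Nat.cast_ne_zero.2 hn)]

variable [TopologicalSpace X] {T : X → X} {x : X} {μ : ProbabilityMeasure X}

/-- The limit distributions of the orbit of `x`: the weak-star cluster points of its empirical
measures. -/
def limitMeasures [OpensMeasurableSpace X] (T : X → X) (x : X) : Set (ProbabilityMeasure X) :=
  {μ | MapClusterPt μ.toFiniteMeasure atTop fun n => empiricalMeasure T n x}

variable [T2Space X] [CompactSpace X] [BorelSpace X]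

lemma limitMeasures_nonempty (T : X → X) (x : X) : (limitMeasures T x).Nonempty := by
  obtain ⟨ν, hν, hcluster⟩ :=
    (isCompact_setOfPred_finiteMeasure_eq_of_compactSpace X 1).exists_mapClusterPt_of_frequently
      ((eventually_ne_atTop 0).mono fun n hn => mass_empiricalMeasure T hn x).frequently
  exact ⟨⟨ν, ⟨by rw [← FiniteMeasure.ennreal_mass, hν.out, ENNReal.coe_one]⟩⟩, hcluster⟩

lemma tendsto_birkhoffAverage_of_tendsto_empiricalMeasure {F : Filter ℕ}
    (h : Tendsto (fun n => empiricalMeasure T n x) F (𝓝 μ.toFiniteMeasure))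
    {f : X → ℝ} (hf : Continuous f) :
    Tendsto (fun n => birkhoffAverage ℝ T f n x) F (𝓝 (∫ y, f y ∂(μ : Measure X))) := by
  have := FiniteMeasure.tendsto_iff_forall_integral_tendsto.1 h
    (BoundedContinuousFunction.mkOfCompact ⟨f, hf⟩)
  simpa [integral_empiricalMeasure] using this

lemma limitMeasures_subset_invariantMeasures [HasOuterApproxClosed X] (hT : Continuous T) (x : X) :
    limitMeasures T x ⊆ invariantMeasures T := fun μ hμ => by
  obtain ⟨U, hU, h⟩ := mapClusterPt_iff_ultrafilter.1 hμ
  refine ⟨hT.measurable, ?_⟩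
  have : IsProbabilityMeasure ((μ : Measure X).map T) :=
    Measure.isProbabilityMeasure_map hT.measurable.aemeasurable
  refine ext_of_forall_integral_eq_of_IsFiniteMeasure fun f => ?_
  rw [integral_map hT.measurable.aemeasurable f.continuous.aestronglyMeasurable]
  have hf := tendsto_birkhoffAverage_of_tendsto_empiricalMeasure h f.continuous
  have hfT := tendsto_birkhoffAverage_of_tendsto_empiricalMeasure h (f.continuous.comp hT)
  have hcomp (n : ℕ) : birkhoffAverage ℝ T (f ∘ T) n x = birkhoffAverage ℝ T f n (T x) := by
    simp only [birkhoffAverage, birkhoffSum, Function.comp_apply,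
      (Function.Commute.iterate_self T _).eq]
  simp only [Function.comp_def] at hcomp hfT
  simp only [hcomp] at hfT
  exact sub_eq_zero.1 (tendsto_nhds_unique (hfT.sub hf)
    ((tendsto_birkhoffAverage_apply_sub_birkhoffAverage' ℝ f.isBounded_range T x).mono_left hU))

end LimitMeasures

section Partition

lemma exists_preimage_singleton_eq_disjointed {X ι : Type*} [LinearOrder ι]
    [LocallyFiniteOrderBot ι] {U : ι → Set X} (hU : ⋃ i, U i = Set.univ) :
    ∃ ξ : X → ι, ∀ i, ξ ⁻¹' {i} = disjointed U i := by
  choose ξ hξ using Set.iUnion_eq_univ_iff.1 ((iUnion_disjointed (f := U)).trans hU)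
  refine ⟨ξ, fun i => Set.ext fun y => ⟨?_, fun hy => ?_⟩⟩
  · rintro rfl
    exact hξ y
  · by_contra hne
    exact Set.disjoint_left.1 (disjoint_disjointed U hne) (hξ y) hy

lemma exists_partition_null_frontier {X : Type*} [PseudoMetricSpace X] [MeasurableSpace X]
    [OpensMeasurableSpace X] {k : ℕ} {c : Fin k → X} {ρ ρ' : ℝ} (hρ : ρ < ρ')
    (hc : ⋃ i, Metric.ball (c i) ρ = Set.univ) (μ : Measure X) [SFinite μ] :
    ∃ ξ : X → Fin k, Measurable ξ ∧ (∀ y, y ∈ Metric.ball (c (ξ y)) ρ') ∧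
      ∀ i, μ (frontier (ξ ⁻¹' {i})) = 0 := by
  choose r hr hr_null using fun i => exists_null_frontier_thickening μ {c i} hρ
  simp only [Metric.thickening_singleton] at hr_null
  let U (i : Fin k) : Set X := Metric.ball (c i) (r i)
  have hU : ⋃ i, U i = Set.univ := Set.univ_subset_iff.1 (hc.ge.trans
    (Set.iUnion_mono fun i => Metric.ball_subset_ball (hr i).1.le))
  obtain ⟨ξ, hξ⟩ := exists_preimage_singleton_eq_disjointed hU
  refine ⟨ξ, measurable_to_countable' fun i => ?_, fun y => ?_, fun i => ?_⟩
  · rw [hξ]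
    exact disjointedRec (fun _ j ht => ht.diff measurableSet_ball) measurableSet_ball
  · have hy : y ∈ disjointed U (ξ y) := hξ (ξ y) ▸ rfl
    exact Metric.ball_subset_ball (hr _).2.le (disjointed_subset U _ hy)
  · rw [hξ]
    refine disjointedRec (p := fun S => μ (frontier S) = 0) (fun t j ht => ?_) (hr_null i)
    rw [Set.sdiff_eq]
    exact null_frontier_inter ht (by rw [frontier_compl]; exact hr_null j)

lemma measure_frontier_iInter_eq_zero {X ι : Type*} [TopologicalSpace X] [MeasurableSpace X]
    [Finite ι] {μ : Measure X} {S : ι → Set X} (h : ∀ i, μ (frontier (S i)) = 0) :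
    μ (frontier (⋂ i, S i)) = 0 := by
  classical
  cases nonempty_fintype ι
  have hfinset (s : Finset ι) : μ (frontier (⋂ i ∈ s, S i)) = 0 := by
    induction s using Finset.induction_on with
    | empty => simp
    | insert a s _ ih =>
      rw [Finset.set_biInter_insert]
      exact null_frontier_inter (h a) ih
  simpa using hfinset Finset.univ

lemma measure_frontier_cylinder_eq_zero {X ι : Type*} [TopologicalSpace X] [MeasurableSpace X]
    [OpensMeasurableSpace X] {T : X → X} (hT : Continuous T) {μ : Measure X}
    (hμ : MeasurePreserving T μ μ) {V : ι → Set X} (hV : ∀ i, μ (frontier (V i)) = 0) {m : ℕ}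
    (u : Fin m → ι) : μ (frontier (cylinder T V u)) = 0 := by
  rw [cylinder_eq_iInter]
  refine measure_frontier_iInter_eq_zero fun j => measure_mono_null
    ((hT.iterate j).frontier_preimage_subset _) ?_
  rw [(hμ.iterate j).measure_preimage isClosed_frontier.measurableSet.nullMeasurableSet]
  exact hV _

end Partition

section Entropy

variable {X ι : Type*} {T : X → X} {ξ : X → ι} {m : ℕ}

/-- The word `ξ y, ξ (T y), …, ξ (T^{m-1} y)` that the first `m` iterates of `y` spell. -/
def itinerary (T : X → X) (ξ : X → ι) (m : ℕ) (y : X) : Fin m → ι :=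
  fun j => ξ (T^[j] y)

lemma itinerary_preimage_singleton (u : Fin m → ι) :
    itinerary T ξ m ⁻¹' {u} = cylinder T (fun i => ξ ⁻¹' {i}) u :=
  Set.ext fun _ => funext_iff

lemma measurable_itinerary [MeasurableSpace X] [MeasurableSpace ι] (hT : Measurable T)
    (hξ : Measurable ξ) : Measurable (itinerary T ξ m) :=
  measurable_pi_lambda _ fun j => hξ.comp (hT.iterate j)

lemma joinEntropy_eq_sum_itinerary [MeasurableSpace X] (T : X → X) (μ : Measure X) {k : ℕ}
    (ξ : X → Fin k) (m : ℕ) :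
    joinEntropy T μ ξ m = ∑ u, Real.negMulLog (μ.real (itinerary T ξ m ⁻¹' {u})) := by
  simp only [itinerary_preimage_singleton]
  rfl

lemma exists_rat_code_of_measureEntropy_lt [MeasurableSpace X] (hT : Measurable T) {μ : Measure X}
    [IsProbabilityMeasure μ] {t : ℝ≥0} (hμ : measureEntropy T μ < t) {k : ℕ} {ξ : X → Fin k}
    (hξ : Measurable ξ) :
    ∃ m : ℕ, 0 < m ∧ ∃ q : (Fin m → Fin k) → ℚ, ∑ u, Real.exp (-(q u : ℝ)) ≤ 1 ∧
      ∑ u, μ.real (itinerary T ξ m ⁻¹' {u}) * q u < m * t := by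
  have hξt : partitionEntropy T μ ξ < t :=
    (le_iSup_of_le k (le_iSup₂ (f := fun η (_ : Measurable η) => partitionEntropy T μ η) ξ hξ))
      |>.trans_lt hμ
  obtain ⟨m, hm_lt, hm⟩ := ((eventually_lt_of_limsup_lt hξt).and (eventually_gt_atTop 0)).exists
  have hm' : (0 : ℝ) < m := Nat.cast_pos.2 hm
  have hcell (u : Fin m → Fin k) : MeasurableSet (itinerary T ξ m ⁻¹' {u}) :=
    measurable_itinerary hT hξ (measurableSet_singleton u)
  have hsum : ∑ u, μ.real (itinerary T ξ m ⁻¹' {u}) = 1 := by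
    rw [sum_measureReal_preimage_singleton _ fun u _ => hcell u]
    simp
  rw [← ENNReal.ofReal_coe_nnreal, ENNReal.ofReal_lt_ofReal_iff', div_lt_iff₀' hm',
    joinEntropy_eq_sum_itinerary] at hm_lt
  exact ⟨m, hm, exists_rat_code (fun u => measureReal_nonneg) hsum hm_lt.1⟩

end Entropy

section BowenBound

lemma mem_codedSet_of_frequently_birkhoffSum_le {X A : Type*} {S : X → X} {V : A → Set X}
    {w : X → A} (hw : ∀ z, z ∈ V (w z)) {q : A → ℝ} {t : ℝ} {y : X}
    (h : ∃ᶠ L : ℕ in atTop, birkhoffSum S (fun z => q (w z)) L y ≤ L * t) :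
    y ∈ codedSet S V q t :=
  h.mono fun L hL => ⟨itinerary S w L y, (Fin.sum_univ_eq_sum_range
    (fun j => q (w (S^[j] y))) L).trans_le hL, fun _ => hw _⟩

lemma frequently_birkhoffSum_comp_le {X A : Type*} [TopologicalSpace X] [HasOuterApproxClosed X]
    [T1Space X] [MeasurableSpace X] [OpensMeasurableSpace X] [Fintype A] [MeasurableSpace A]
    [MeasurableSingletonClass A] {T : X → X} {x : X} {μ : ProbabilityMeasure X}
    (hμ : μ ∈ limitMeasures T x) {w : X → A} (hw : Measurable w)
    (hwf : ∀ a, (μ : Measure X) (frontier (w ⁻¹' {a})) = 0) {g : A → ℝ} {c : ℝ}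
    (hc : ∑ a, (μ : Measure X).real (w ⁻¹' {a}) * g a < c) :
    ∃ᶠ n : ℕ in atTop, birkhoffSum T (fun y => g (w y)) n x ≤ n * c := by
  obtain ⟨U, hU, h⟩ := mapClusterPt_iff_ultrafilter.1 hμ
  have hlim := tendsto_integral_comp_of_null_frontier h hw hwf g
  have hev : ∀ᶠ n : ℕ in U, birkhoffSum T (fun y => g (w y)) n x ≤ n * c := by
    filter_upwards [hlim.eventually_lt_const hc, hU (eventually_gt_atTop 0)] with n hn hn0
    rw [integral_empiricalMeasure, birkhoffAverage, smul_eq_mul,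
      inv_mul_lt_iff₀ (Nat.cast_pos.2 hn0)] at hn
    exact hn.le
  exact hev.frequently.filter_mono hU

variable {X : Type*} [MetricSpace X] [CompactSpace X] [MeasurableSpace X] [BorelSpace X]
  {T : X → X}

lemma exists_iterate_mem_codedSet (hT : Continuous T) {k : ℕ} {c : Fin k → X} {ρ ρ' : ℝ}
    (hρ : ρ < ρ') (hc : ⋃ i, Metric.ball (c i) ρ = Set.univ) {x : X} {μ : ProbabilityMeasure X}
    (hμ : μ ∈ limitMeasures T x) {t : ℝ≥0} (hμt : measureEntropy T (μ : Measure X) < t) :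
    ∃ m : ℕ, 0 < m ∧ ∃ q : (Fin m → Fin k) → ℚ, ∑ u, Real.exp (-(q u : ℝ)) ≤ 1 ∧
      ∃ r, T^[r] x ∈ codedSet T^[m] (cylinder T fun i => Metric.ball (c i) ρ')
        (fun u => (q u : ℝ)) (m * t) := by
  obtain ⟨ξ, hξ, hξ_ball, hξ_null⟩ := exists_partition_null_frontier hρ hc (μ : Measure X)
  obtain ⟨m, hm, q, hq, hqt⟩ := exists_rat_code_of_measureEntropy_lt hT.measurable hμt hξ
  have hnull (u) : (μ : Measure X) (frontier (itinerary T ξ m ⁻¹' {u})) = 0 := by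
    rw [itinerary_preimage_singleton]
    exact measure_frontier_cylinder_eq_zero hT (limitMeasures_subset_invariantMeasures hT x hμ)
      hξ_null u
  obtain ⟨c', hqc', hc't⟩ := exists_between hqt
  have hsum := frequently_birkhoffSum_comp_le hμ (measurable_itinerary hT.measurable hξ) hnull hqc'
  obtain ⟨a, ha⟩ := (Set.finite_range fun u => (q u : ℝ)).bddBelow
  obtain ⟨r, hr⟩ := exists_frequently_birkhoffSum_iterate_le
    (frequently_birkhoffSum_mul_le (fun y => ha ⟨itinerary T ξ m y, rfl⟩) hm hc't hsum) hm
  have hcell (z) : z ∈ cylinder T (fun i => Metric.ball (c i) ρ') (itinerary T ξ m z) :=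
    fun j => hξ_ball (T^[j] z)
  exact ⟨m, hm, q, hq, r, mem_codedSet_of_frequently_birkhoffSum_le hcell hr⟩

lemma bowenMeasure_eq_zero_of_forall_exists_limitMeasure (hT : Continuous T) {Z : Set X}
    {t s : ℝ≥0} (hts : t < s) {ε : ℝ} (hε : 0 < ε)
    (hZ : ∀ x ∈ Z, ∃ μ ∈ limitMeasures T x, measureEntropy T (μ : Measure X) < t) :
    bowenMeasure T s Z ε = 0 := by
  obtain ⟨k, c, hc⟩ := exists_fin_cover_ball (X := X) (show 0 < ε / 8 by positivity)
  let V (i : Fin k) : Set X := Metric.ball (c i) (ε / 4)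
  have hV (m : ℕ) (u : Fin m → Fin k) : ∀ y ∈ cylinder T V u,
      cylinder T V u ⊆ bowenBall T m y (ε / 2) := fun y hy z hz =>
    mem_bowenBall_of_mem_cylinder (fun i y hy =>
      (ball_subset_ball_two_mul hy).trans_eq (by ring_nf)) hy hz
  let J := Σ m : ℕ, {q : (Fin m → Fin k) → ℚ // 0 < m ∧ ∑ u, Real.exp (-(q u : ℝ)) ≤ 1} × ℕ
  let W (i : J) : Set X :=
    T^[i.2.2] ⁻¹' codedSet T^[i.1] (cylinder T V) (fun u => (i.2.1.1 u : ℝ)) (i.1 * t)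
  have hcover : Z ⊆ ⋃ i, W i := fun x hx => by
    obtain ⟨μ, hμ, hμt⟩ := hZ x hx
    obtain ⟨m, hm, q, hq, r, hr⟩ :=
      exists_iterate_mem_codedSet hT (show ε / 8 < ε / 4 by linarith) hc hμ hμt
    exact Set.mem_iUnion.2 ⟨⟨m, ⟨q, hm, hq⟩, r⟩, hr⟩
  have hW (i) : bowenMeasure T s (W i) ε = 0 := by
    obtain ⟨m, ⟨q, hm, hq⟩, r⟩ := i
    have hcoded := bowenMeasure_codedSet_eq_zero (hV m) hm hq (t := m * t) (s := s) (by
      rw [mul_comm]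
      gcongr)
    simpa only [mul_div_cancel₀ ε two_ne_zero] using
      bowenMeasure_preimage_iterate_eq_zero (half_pos hε) r hcoded
  refine le_bot_iff.1 ((bowenMeasure_mono hcover).trans ((bowenMeasure_iUnion_le W).trans_eq ?_))
  simp only [hW, tsum_zero, bot_eq_zero]

-- Theorem 2 in Bowen, *Topological entropy for noncompact sets* (1973).
theorem topEntropy_le_of_forall_exists_limitMeasure (hT : Continuous T) {Z : Set X} {t : ℝ≥0∞}
    (hZ : ∀ x ∈ Z, ∃ μ ∈ limitMeasures T x, measureEntropy T (μ : Measure X) ≤ t) :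
    topEntropy T Z ≤ t := by
  refine iSup₂_le fun ε hε => le_of_forall_gt fun a ha => ?_
  obtain ⟨s, hts, hsa⟩ := ENNReal.lt_iff_exists_nnreal_btwn.1 ha
  obtain ⟨t', htt', ht's⟩ := ENNReal.lt_iff_exists_nnreal_btwn.1 hts
  refine (iInf₂_le s (bowenMeasure_eq_zero_of_forall_exists_limitMeasure hT
    (ENNReal.coe_lt_coe.1 ht's) hε fun x hx => ?_)).trans_lt hsa
  obtain ⟨μ, hμ, hμt⟩ := hZ x hx
  exact ⟨μ, hμ, hμt.trans_lt htt'⟩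

theorem topEntropy_eq_iSup_measureEntropy (hT : Continuous T) {Z : Set X}
    {𝓜 : Set (ProbabilityMeasure X)} (hZ : ∀ x ∈ Z, limitMeasures T x ⊆ 𝓜)
    (hgen : ∀ μ ∈ 𝓜, genericPoints T μ ⊆ Z)
    (hent : ∀ μ ∈ 𝓜, measureEntropy T (μ : Measure X) ≤ topEntropy T (genericPoints T μ)) :
    topEntropy T Z = ⨆ μ ∈ 𝓜, measureEntropy T (μ : Measure X) := by
  refine le_antisymm (topEntropy_le_of_forall_exists_limitMeasure hT fun x hx => ?_)
    (iSup₂_le fun μ hμ => (hent μ hμ).trans (topEntropy_mono (hgen μ hμ)))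
  obtain ⟨μ, hμ⟩ := limitMeasures_nonempty T x
  exact ⟨μ, hμ, le_iSup₂ (f := fun (ν : ProbabilityMeasure X) (_ : ν ∈ 𝓜) =>
    measureEntropy T (ν : Measure X)) μ (hZ x hx hμ)⟩

end BowenBound

section Level

variable {X B : Type*} [NormedAddCommGroup B] [NormedSpace ℝ B] {T : X → X}
  {Φ : X → WeakDual ℝ B} {α : WeakDual ℝ B} {E : Set B}

lemma birkhoffAverage_weakDual_apply (T : X → X) (Φ : X → WeakDual ℝ B) (n : ℕ) (x : X) (w : B) :
    birkhoffAverage ℝ T Φ n x w = birkhoffAverage ℝ T (fun y => Φ y w) n x :=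
  map_birkhoffAverage ℝ ℝ (LinearMap.applyₗ w ∘ₗ ContinuousLinearMap.coeLM ℝ) T Φ n x

variable [MetricSpace X] [CompactSpace X] [MeasurableSpace X] [BorelSpace X]
  {μ : ProbabilityMeasure X} {x : X}

lemma tendsto_birkhoffAverage_weakDual (hΦ : Continuous Φ) {F : Filter ℕ}
    (h : Tendsto (fun n => empiricalMeasure T n x) F (𝓝 μ.toFiniteMeasure)) (w : B) :
    Tendsto (fun n => ((birkhoffAverage ℝ T Φ n x w : ℝ) : EReal)) F
      (𝓝 ((∫ y, Φ y w ∂(μ : Measure X) : ℝ) : EReal)) := by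
  simp only [birkhoffAverage_weakDual_apply]
  exact (continuous_coe_real_ereal.tendsto _).comp
    (tendsto_birkhoffAverage_of_tendsto_empiricalMeasure h ((WeakDual.eval_continuous w).comp hΦ))

lemma limitMeasures_subset_levelMeasures (hT : Continuous T) (hΦ : Continuous Φ)
    (hx : x ∈ levelSet T Φ α E) : limitMeasures T x ⊆ levelMeasures T Φ α E := fun μ hμ => by
  refine ⟨limitMeasures_subset_invariantMeasures hT x hμ, fun w hw => EReal.coe_le_coe_iff.1 ?_⟩
  obtain ⟨U, hU, h⟩ := mapClusterPt_iff_ultrafilter.1 hμ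
  rw [← (tendsto_birkhoffAverage_weakDual hΦ h w).limsup_eq]
  exact (limsup_le_limsup_of_le hU).trans (hx w hw)

lemma genericPoints_subset_levelSet (hΦ : Continuous Φ) (hμ : μ ∈ levelMeasures T Φ α E) :
    genericPoints T μ ⊆ levelSet T Φ α E := fun x hx w hw => by
  rw [(tendsto_birkhoffAverage_weakDual hΦ hx w).limsup_eq]
  exact EReal.coe_le_coe_iff.2 (hμ.2 w hw)

end Level

end DynSys

end

theorem theorem2_general {X : Type*} [MetricSpace X] [CompactSpace X] [MeasurableSpace X]
    [BorelSpace X] {B : Type*} [NormedAddCommGroup B] [NormedSpace ℝ B]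
    (T : X → X) (hT : Continuous T) (Φ : X → WeakDual ℝ B) (hΦ : Continuous Φ) (α : WeakDual ℝ B)
    (E : Set B)
    (hent : ∀ μ ∈ DynSys.levelMeasures T Φ α E, DynSys.measureEntropy T (μ : Measure X) ≤
      DynSys.topEntropy T (DynSys.genericPoints T μ)) :
    (DynSys.levelMeasures T Φ α E = ∅ → DynSys.levelSet T Φ α E = ∅) ∧
    DynSys.topEntropy T (DynSys.levelSet T Φ α E) =
      ⨆ μ ∈ DynSys.levelMeasures T Φ α E, DynSys.measureEntropy T (μ : Measure X) := by
  have hlim : ∀ x ∈ DynSys.levelSet T Φ α E,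
      DynSys.limitMeasures T x ⊆ DynSys.levelMeasures T Φ α E :=
    fun _ hx => DynSys.limitMeasures_subset_levelMeasures hT hΦ hx
  refine ⟨fun hempty => Set.eq_empty_of_forall_notMem fun x hx => ?_,
    DynSys.topEntropy_eq_iSup_measureEntropy hT hlim
      (fun _ hμ => DynSys.genericPoints_subset_levelSet hΦ hμ) hent⟩
  exact ((DynSys.limitMeasures_nonempty T x).mono (hlim x hx)).ne_empty hempty

theorem theorem2 {X : Type*} [MetricSpace X] [CompactSpace X] [MeasurableSpace X] [BorelSpace X]
    {B : Type*} [NormedAddCommGroup B] [NormedSpace ℝ B] [CompleteSpace B]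
    (T : X → X) (hT : Continuous T) (hsat : DynSys.IsSaturated T)
    (Φ : X → WeakDual ℝ B) (hΦ : Continuous Φ) (α : WeakDual ℝ B) (E : Set B) :
    (DynSys.levelMeasures T Φ α E = ∅ → DynSys.levelSet T Φ α E = ∅) ∧
    ((DynSys.levelMeasures T Φ α E).Nonempty →
      DynSys.topEntropy T (DynSys.levelSet T Φ α E) =
        ⨆ μ ∈ DynSys.levelMeasures T Φ α E, DynSys.measureEntropy T (μ : Measure X)) :=
  (theorem2_general T hT Φ hΦ α E fun μ hμ => (hsat μ hμ.1).ge).imp_right fun h _ => h
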